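/- **Definitions.** A variety is the class of all algebras of a given similarity type (finitary operations) that satisfy a given set of identities. It is *locally finite* if every finitely generated subalgebra of each of its members is finite. For an integer $n\ge 3$, an *$n$-near-unanimity term* of a variety $\mathcal V$ is an $n$-ary term $u$ such that $\mathcal V$ satisfies all the identities $u(x,\dots,x,y,x,\dots,x)=x$, with exactly one occurrence of $y$, in any position. For an integer $n\ge 2$, an *$(n+\tfrac12)$-near-unanimity term* of $\mathcal V$ is an $(n+2)$-ary term $u$ such that $\mathcal V$ satisfies $$u(z,z,x,x,\dots,x)=x,\qquad u(x,\dots,x,\underset{i}{z},x,\dots,x)=x\quad(2\le i\le n+2),$$ $$u(x,x,x,z,z,\dots,z)=u(x,z,z,z,z,\dots,z).$$ For a natural number $k$, $\mathcal V$ is *$k$-distributive* if it has ternary terms $t_0,\dots,t_k$ (Jónsson terms) satisfying $t_0(x,y,z)=x$; $t_i(x,y,x)=x$ for $0\le i\le k$; $t_i(x,x,z)=t_{i+1}(x,x,z)$ for even $i$, $0\le i<k$; $t_i(x,z,z)=t_{i+1}(x,z,z)$ for odd $i$, $0\le i<k$; and $t_k(x,y,z)=z$. It is *$k$-modular* if it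 has $4$-ary terms $t_0,\dots,t_k$ (Day terms) satisfying $t_i(x,y,y,x)=x$ for $0\le i\le k$; $t_0(x,y,z,w)=x$; $t_i(x,x,w,w)=t_{i+1}(x,x,w,w)$ for even $i$, $0\le i<k$; $t_i(x,y,y,w)=t_{i+1}(x,y,y,w)$ for odd $i$, $0\le i<k$; and $t_k(x,y,z,w)=w$. **Theorem.** Suppose that $h,k\in\mathbb N\cup(\mathbb N+\tfrac12)$ and $h,k\ge 3$. 1. If $h<k$, then every variety with an $h$-near-unanimity term has a $k$-near-unanimity term, and there is a locally finite variety with a $k$-near-unanimity term but without an $h$-near-unanimity term. 2. Every variety with an $h$-near-unanimity term is $(2h-4)$-distributive. There is a locally finite variety with an $h$-near-unanimity term which is not $(2h-5)$-distributive. 3. Every variety with an $h$-near-unanimity term is $(2h-3)$-modular. If $h\ge 4$, there is a locally finite variety with an $h$-near-unanimity term which is not $(2h-4)$-modular. -/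

import Mathlib

universe u

/-- A variety, presented by a similarity type (an algebraic first-order language) and a set of
identities in countably many variables. Its members are the algebras satisfying all of the
identities. -/
structure Variety where
  lang : FirstOrder.Language.{u, 0}
  isAlgebraic : lang.IsAlgebraic
  identities : Set (lang.Term ℕ × lang.Term ℕ)

namespace Variety

/-- The algebra `A` belongs to the variety `V`. -/
def Mem (V : Variety.{u}) (A : Type u) [V.lang.Structure A] : Prop :=
  ∀ e ∈ V.identities, ∀ v : ℕ → A, e.1.realize v = e.2.realize v

/-- Every finitely generated subalgebra of a member of `V` is finite. -/
def LocallyFinite (V : Variety.{u}) : Prop :=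
  ∀ (A : Type u) [V.lang.Structure A], V.Mem A →
    ∀ S : V.lang.Substructure A, S.FG → Finite S

/-- `t` is an `n`-ary near-unanimity term of `V`. -/
def IsNUTerm (V : Variety.{u}) (n : ℕ) (t : V.lang.Term (Fin n)) : Prop :=
  3 ≤ n ∧ ∀ (A : Type u) [V.lang.Structure A], V.Mem A →
    ∀ (i : Fin n) (x y : A), t.realize (Function.update (fun _ => x) i y) = x

/-- `t` is an `(n + 1/2)`-near-unanimity term of `V`: an `(n + 2)`-ary term such that
* `t(z, z, x, x, …, x) = x`;
* `t(x, …, x, z, x, …, x) = x`, with `z` in any one place but the first;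
* `t(x, x, x, z, z, …, z) = t(x, z, z, z, z, …, z)`. -/
def IsHalfNUTerm (V : Variety.{u}) (n : ℕ) (t : V.lang.Term (Fin (n + 2))) : Prop :=
  2 ≤ n ∧ ∀ (A : Type u) [V.lang.Structure A], V.Mem A → ∀ x z : A,
    t.realize (fun j => if j.val < 2 then z else x) = x ∧
    (∀ i : Fin (n + 2), i ≠ 0 → t.realize (Function.update (fun _ => x) i z) = x) ∧
    t.realize (fun j => if j.val < 3 then x else z) =
      t.realize (fun j => if j.val < 1 then x else z)

/-- `V` has an `h`-near-unanimity term, where `h` is an integer or a half-integer. -/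
def HasNUTerm (V : Variety.{u}) (h : ℚ) : Prop :=
  (∃ n : ℕ, h = n ∧ ∃ t : V.lang.Term (Fin n), V.IsNUTerm n t) ∨
  (∃ n : ℕ, h = n + 1 / 2 ∧ ∃ t : V.lang.Term (Fin (n + 2)), V.IsHalfNUTerm n t)

/-- `V` is `k`-distributive: it has Jónsson terms `t 0, …, t k`
(the values of `t` at indices above `k` are irrelevant). -/
def IsDistributive (V : Variety.{u}) (k : ℕ) : Prop :=
  ∃ t : ℕ → V.lang.Term (Fin 3), ∀ (A : Type u) [V.lang.Structure A], V.Mem A →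
    (∀ x y z : A, (t 0).realize ![x, y, z] = x) ∧
    (∀ i ≤ k, ∀ x y : A, (t i).realize ![x, y, x] = x) ∧
    (∀ i < k, Even i → ∀ x z : A,
      (t i).realize ![x, x, z] = (t (i + 1)).realize ![x, x, z]) ∧
    (∀ i < k, Odd i → ∀ x z : A,
      (t i).realize ![x, z, z] = (t (i + 1)).realize ![x, z, z]) ∧
    (∀ x y z : A, (t k).realize ![x, y, z] = z)

/-- `V` is `k`-modular: it has Day terms `t 0, …, t k`
(the values of `t` at indices above `k` are irrelevant). -/
def IsModular (V : Variety.{u}) (k : ℕ) : Prop :=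
  ∃ t : ℕ → V.lang.Term (Fin 4), ∀ (A : Type u) [V.lang.Structure A], V.Mem A →
    (∀ i ≤ k, ∀ x y : A, (t i).realize ![x, y, y, x] = x) ∧
    (∀ x y z w : A, (t 0).realize ![x, y, z, w] = x) ∧
    (∀ i < k, Even i → ∀ x w : A,
      (t i).realize ![x, x, w, w] = (t (i + 1)).realize ![x, x, w, w]) ∧
    (∀ i < k, Odd i → ∀ x y w : A,
      (t i).realize ![x, y, y, w] = (t (i + 1)).realize ![x, y, y, w]) ∧
    (∀ x y z w : A, (t k).realize ![x, y, z, w] = w)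

end Variety

/-- `h` belongs to `ℕ ∪ (ℕ + 1/2)`. -/
def IsIntegerOrHalfInteger (h : ℚ) : Prop :=
  ∃ n : ℕ, h = n ∨ h = n + 1 / 2

open FirstOrder Language

namespace Variety

/-! ### Near-unanimity terms yield Jónsson and Day terms. -/

section Positive

variable {V : Variety.{u}} {n : ℕ}

/-! Writing `h = N / 2` makes the claims uniform in `N`. For the positive bounds, the arguments of
the near-unanimity term are changed from the first variable to the last one at a time, from the
right. Each intermediate term has one pivot argument, absorbed by near-unanimity. In the
half-integer case the identity `u(x,x,x,z,…,z) = u(x,z,z,…,z)` lets the chain jump over two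
positions.

The counterexamples are generated by finitely many two-element algebras sharing one operation
symbol, interpreted by threshold functions for a weight and by one further function `f` whose false
inputs have weight at most 2. Given Jónsson terms, in each threshold algebra the values `t_i(1,1,0)`
go from true to false; even links preserve `t_i(1,1,0)` and odd links preserve `t_i(1,0,0)`, so some
odd `i` has `t_i(1,1,0)` true and `t_i(1,0,0)` false (`exists_odd_of_links`). Two thresholds cannot
use the same `i`: since `t_i(0,1,0)` is false for `f`, subadditivity of weight would carry falsity
from the lower threshold at `(1,0,0)` to the higher one at `(1,1,0)`
(`boolEval_threshold_eq_false_of_lt`). Hence many thresholds force many terms. Day terms are treated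
likewise, with an additional even index after each odd one (`exists_even_of_links`).

Strictness of the hierarchy follows from the distributivity bounds. -/

theorem IsNUTerm.realize_eq {t : V.lang.Term (Fin n)} (ht : V.IsNUTerm n t)
    {A : Type u} [V.lang.Structure A] (hA : V.Mem A) (c : ℕ) (hc : c < n) (x : A) (f : Fin n → A)
    (hf : ∀ p : Fin n, p.val ≠ c → f p = x) : t.realize f = x := by
  have : f = Function.update (fun _ => x) ⟨c, hc⟩ (f ⟨c, hc⟩) := by
    funext p
    by_cases hp : p = ⟨c, hc⟩
    · subst hp; simp
    · rw [Function.update_of_ne hp]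
      exact hf p fun h => hp (Fin.ext h)
  rw [this]
  exact ht.2 A hA _ _ _

theorem IsHalfNUTerm.realize_eq {t : V.lang.Term (Fin (n + 2))} (ht : V.IsHalfNUTerm n t)
    {A : Type u} [V.lang.Structure A] (hA : V.Mem A) (c : ℕ) (hc : c < n + 2) (hc0 : 0 < c) (x : A)
    (f : Fin (n + 2) → A) (hf : ∀ p : Fin (n + 2), p.val ≠ c → f p = x) : t.realize f = x := by
  have : f = Function.update (fun _ => x) ⟨c, hc⟩ (f ⟨c, hc⟩) := by
    funext p
    by_cases hp : p = ⟨c, hc⟩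
    · subst hp; simp
    · rw [Function.update_of_ne hp]
      exact hf p fun h => hp (Fin.ext h)
  rw [this]
  refine (ht.2 A hA x _).2.1 _ fun h => ?_
  have := congrArg Fin.val h
  simp at this
  omega

theorem IsHalfNUTerm.realize_eq_of_two_le {t : V.lang.Term (Fin (n + 2))}
    (ht : V.IsHalfNUTerm n t) {A : Type u} [V.lang.Structure A] (hA : V.Mem A) (x z : A)
    (f : Fin (n + 2) → A) (hf : ∀ p : Fin (n + 2), f p = if p.val < 2 then z else x) :
    t.realize f = x := by
  rw [show f = _ from funext hf]
  exact (ht.2 A hA x z).1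

theorem IsHalfNUTerm.realize_eq_realize {t : V.lang.Term (Fin (n + 2))}
    (ht : V.IsHalfNUTerm n t) {A : Type u} [V.lang.Structure A] (hA : V.Mem A) (x z : A)
    (f g : Fin (n + 2) → A) (hf : ∀ p : Fin (n + 2), f p = if p.val < 3 then x else z)
    (hg : ∀ p : Fin (n + 2), g p = if p.val < 1 then x else z) :
    t.realize f = t.realize g := by
  rw [show f = _ from funext hf, show g = _ from funext hg]
  exact (ht.2 A hA x z).2.2

/-- Two dummy arguments are put in front; both sides of the last identity then reduce to `z`. -/
theorem IsNUTerm.exists_isHalfNUTerm {t : V.lang.Term (Fin n)} (ht : V.IsNUTerm n t) :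
    ∃ s : V.lang.Term (Fin (n + 2)), V.IsHalfNUTerm n s := by
  have hn := ht.1
  refine ⟨t.relabel fun p => p.natAdd 2 |>.cast (Nat.add_comm 2 n), by omega, fun A _ hA x z => ?_⟩
  simp only [Term.realize_relabel]
  refine ⟨ht.realize_eq hA 0 (by omega) _ _ fun p _ => ?_, fun i hi => ?_, ?_⟩
  · simp
  · refine ht.realize_eq hA (i.val - 2) (by omega) _ _ fun p hp => ?_
    refine Function.update_of_ne (fun h => hp ?_) _ _
    simp [← h]
  · rw [ht.realize_eq hA 0 (by omega) z, ht.realize_eq hA 0 (by omega) z] <;>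
    · intro p hp
      simp only [Function.comp, Fin.val_cast, Fin.val_natAdd]
      rw [if_neg (by omega)]

/-- The first two arguments are identified, so `u(z,z,x,…,x) = x` covers the new first place. -/
theorem IsHalfNUTerm.exists_isNUTerm {t : V.lang.Term (Fin (n + 2))} (ht : V.IsHalfNUTerm n t) :
    ∃ s : V.lang.Term (Fin (n + 1)), V.IsNUTerm (n + 1) s := by
  have hn := ht.1
  refine ⟨t.relabel fun p => ⟨p.val - 1, by omega⟩, by omega, fun A _ hA i x y => ?_⟩
  simp only [Term.realize_relabel]
  by_cases hi : i.val = 0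
  · refine ht.realize_eq_of_two_le hA x y _ fun p => ?_
    have : i = 0 := Fin.ext hi
    subst this
    simp only [Function.comp, Function.update_apply, Fin.ext_iff, Fin.val_zero]
    split_ifs <;> first | rfl | (exfalso; omega)
  · refine ht.realize_eq hA (i.val + 1) (by omega) (by omega) _ _ fun p hp => ?_
    simp only [Function.comp, Function.update_apply, Fin.ext_iff]
    rw [if_neg (by omega)]

theorem IsNUTerm.isDistributive {t : V.lang.Term (Fin n)} (ht : V.IsNUTerm n t) :
    V.IsDistributive (2 * n - 4) := by
  have hn := ht.1
  -- The pivot, at place `n - 1 - (i + 1) / 2`, holds `y` for odd `i` and `z` for even `i`; it runs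
  -- from the last place down to place 1, where `u(x,z,…,z) = z`.
  refine ⟨fun i => t.relabel fun p => if p.val < n - 1 - (i + 1) / 2 then 0 else
    if p.val = n - 1 - (i + 1) / 2 ∧ i % 2 = 1 then 1 else 2, fun A _ hA => ?_⟩
  simp only [Term.realize_relabel, Nat.even_iff, Nat.odd_iff]
  refine ⟨fun x y z => ht.realize_eq hA (n - 1) (by omega) _ _ fun p hp => ?_,
    fun i hi x y => ht.realize_eq hA (n - 1 - (i + 1) / 2) (by omega) _ _ fun p hp => ?_,
    fun i hi he x z => congrArg t.realize (funext fun p => ?_),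
    fun i hi he x z => congrArg t.realize (funext fun p => ?_),
    fun x y z => ht.realize_eq hA 0 (by omega) _ _ fun p hp => ?_⟩ <;>
  simp only [Function.comp] <;> split_ifs <;> first | rfl | (exfalso; omega)

theorem IsNUTerm.isModular {t : V.lang.Term (Fin n)} (ht : V.IsNUTerm n t) :
    V.IsModular (2 * n - 3) := by
  have hn := ht.1
  -- Here the pivot goes on to place 0: the last term is `u(y,w,…,w)`, one step longer than the
  -- Jónsson chain.
  refine ⟨fun i => t.relabel fun p => if p.val < n - 1 - (i + 1) / 2 then 0 else
    if p.val = n - 1 - (i + 1) / 2 then (if i % 2 = 1 then 1 else 2) else 3, fun A _ hA => ?_⟩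
  simp only [Term.realize_relabel, Nat.even_iff, Nat.odd_iff]
  refine ⟨fun i hi x y => ht.realize_eq hA (n - 1 - (i + 1) / 2) (by omega) _ _ fun p hp => ?_,
    fun x y z w => ht.realize_eq hA (n - 1) (by omega) _ _ fun p hp => ?_,
    fun i hi he x w => congrArg t.realize (funext fun p => ?_),
    fun i hi he x y w => congrArg t.realize (funext fun p => ?_),
    fun x y z w => ht.realize_eq hA 0 (by omega) _ _ fun p hp => ?_⟩ <;>
  simp only [Function.comp] <;> split_ifs <;> first | rfl | (exfalso; omega)

theorem IsHalfNUTerm.isDistributive {t : V.lang.Term (Fin (n + 2))} (ht : V.IsHalfNUTerm n t)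
    (hn : 3 ≤ n) : V.IsDistributive (2 * n - 3) := by
  -- The pivot stops at place 3 with `u(x,x,x,y,z,…,z)`. The next term `u(x,y,z,…,z)` is reached by
  -- the jump identity, and `u(x,x,z,…,z) = z` links it to the final projection.
  refine ⟨fun i => t.relabel fun p =>
    if i < 2 * n - 4 then
      if p.val < n + 1 - (i + 1) / 2 then 0 else
        if p.val = n + 1 - (i + 1) / 2 ∧ i % 2 = 1 then 1 else 2
    else if i = 2 * n - 4 then
      if p.val = 0 then 0 else if p.val = 1 then 1 else 2
    else 2, fun A _ hA => ?_⟩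
  simp only [Term.realize_relabel, Nat.even_iff, Nat.odd_iff]
  refine ⟨fun x y z => ht.realize_eq hA (n + 1) (by omega) (by omega) _ _ fun p hp => ?_,
    fun i hi x y => ?_, fun i hi he x z => ?_, fun i hi he x z => ?_,
    fun x y z => ht.realize_eq hA 1 (by omega) (by omega) _ _ fun p hp => ?_⟩
  · simp only [Function.comp]; split_ifs <;> first | rfl | (exfalso; omega)
  · refine ht.realize_eq hA (if i < 2 * n - 4 then n + 1 - (i + 1) / 2 else 1)
      (by split_ifs <;> omega) (by split_ifs <;> omega) _ _ fun p hp => ?_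
    simp only [Function.comp]; split_ifs at hp ⊢ <;> first | rfl | (exfalso; omega)
  · by_cases h : i = 2 * n - 4
    · rw [ht.realize_eq_of_two_le hA z x, ht.realize_eq hA 1 (by omega) (by omega) z] <;>
      intros <;> simp only [Function.comp] <;> split_ifs <;> first | rfl | (exfalso; omega)
    · refine congrArg t.realize (funext fun p => ?_)
      simp only [Function.comp]; split_ifs <;> first | rfl | (exfalso; omega)
  · by_cases h : i = 2 * n - 5
    · refine ht.realize_eq_realize hA x z _ _ (fun p => ?_) (fun p => ?_) <;>
      simp only [Function.comp] <;> split_ifs <;> first | rfl | (exfalso; omega)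
    · refine congrArg t.realize (funext fun p => ?_)
      simp only [Function.comp]; split_ifs <;> first | rfl | (exfalso; omega)
  · simp only [Function.comp]; split_ifs <;> first | rfl | (exfalso; omega)

theorem IsHalfNUTerm.isModular {t : V.lang.Term (Fin (n + 2))} (ht : V.IsHalfNUTerm n t)
    (hn : 3 ≤ n) : V.IsModular (2 * n - 2) := by
  -- The jump goes from `u(x,x,x,z,w,…,w)` to `u(y,z,w,…,w)`; with `y = z` the latter is `w`, which
  -- gives both its absorption identity and its link to the final projection.
  refine ⟨fun i => t.relabel fun p =>
    if i < 2 * n - 3 then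
      if p.val < n + 1 - (i + 1) / 2 then 0 else
        if p.val = n + 1 - (i + 1) / 2 then (if i % 2 = 1 then 1 else 2) else 3
    else if i = 2 * n - 3 then
      if p.val = 0 then 1 else if p.val = 1 then 2 else 3
    else 3, fun A _ hA => ?_⟩
  simp only [Term.realize_relabel, Nat.even_iff, Nat.odd_iff]
  refine ⟨fun i hi x y => ?_,
    fun x y z w => ht.realize_eq hA (n + 1) (by omega) (by omega) _ _ fun p hp => ?_,
    fun i hi he x w => ?_, fun i hi he x y w => ?_,
    fun x y z w => ht.realize_eq hA 1 (by omega) (by omega) _ _ fun p hp => ?_⟩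
  · by_cases h : i = 2 * n - 3
    · refine ht.realize_eq_of_two_le hA x y _ fun p => ?_
      simp only [Function.comp]; split_ifs <;> first | rfl | (exfalso; omega)
    · refine ht.realize_eq hA (if i < 2 * n - 3 then n + 1 - (i + 1) / 2 else 1)
        (by split_ifs <;> omega) (by split_ifs <;> omega) _ _ fun p hp => ?_
      simp only [Function.comp]; split_ifs at hp ⊢ <;> rfl
  · simp only [Function.comp]; split_ifs <;> first | rfl | (exfalso; omega)
  · by_cases h : i = 2 * n - 4
    · refine ht.realize_eq_realize hA x w _ _ (fun p => ?_) (fun p => ?_) <;>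
      simp only [Function.comp] <;> split_ifs <;> first | rfl | (exfalso; omega)
    · refine congrArg t.realize (funext fun p => ?_)
      simp only [Function.comp]; split_ifs <;> first | rfl | (exfalso; omega)
  · by_cases h : i = 2 * n - 3
    · rw [ht.realize_eq_of_two_le hA w y, ht.realize_eq hA 1 (by omega) (by omega) w] <;>
      intros <;> simp only [Function.comp] <;> split_ifs <;> first | rfl | (exfalso; omega)
    · refine congrArg t.realize (funext fun p => ?_)
      simp only [Function.comp]; split_ifs <;> first | rfl | (exfalso; omega)
  · simp only [Function.comp]; split_ifs <;> first | rfl | (exfalso; omega)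

theorem IsDistributive.mono {k l : ℕ} (hV : V.IsDistributive k) (hkl : k ≤ l) :
    V.IsDistributive l := by
  obtain ⟨t, ht⟩ := hV
  refine ⟨fun i => if i < k then t i else .var 2, fun A _ hA => ?_⟩
  obtain ⟨h0, h1, h2, h3, h4⟩ := ht A hA
  have key : ∀ i ≤ k, ∀ v : Fin 3 → A,
      (if i < k then t i else .var 2).realize v = (t i).realize v := by
    intro i hi v
    split_ifs with h
    · rfl
    · obtain rfl : i = k := by omega
      rw [show v = ![v 0, v 1, v 2] by funext j; fin_cases j <;> rfl, h4]
      rfl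
  refine ⟨fun x y z => (key 0 (by omega) _).trans (h0 x y z), fun i _ x y => ?_,
    fun i _ he x z => ?_, fun i _ he x z => ?_, fun x y z => ?_⟩
  · by_cases h : i < k
    · rw [key i h.le, h1 i h.le]
    · simp [h]
  · by_cases h : i < k
    · rw [key i h.le, key (i + 1) h, h2 i h he]
    · simp [h, show ¬ i + 1 < k by omega]
  · by_cases h : i < k
    · rw [key i h.le, key (i + 1) h, h3 i h he]
    · simp [h, show ¬ i + 1 < k by omega]
  · simp [show ¬ l < k by omega]

theorem hasNUTerm_natCast : V.HasNUTerm n ↔ ∃ t : V.lang.Term (Fin n), V.IsNUTerm n t := by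
  constructor
  · rintro (⟨m, hm, ht⟩ | ⟨m, hm, -⟩)
    · obtain rfl : n = m := by exact_mod_cast hm
      exact ht
    · have : (2 * n : ℚ) = 2 * m + 1 := by linarith
      norm_cast at this
      omega
  · exact fun h => Or.inl ⟨n, rfl, h⟩

theorem hasNUTerm_natCast_add_half :
    V.HasNUTerm (n + 1 / 2) ↔ ∃ t : V.lang.Term (Fin (n + 2)), V.IsHalfNUTerm n t := by
  constructor
  · rintro (⟨m, hm, -⟩ | ⟨m, hm, ht⟩)
    · have : (2 * n + 1 : ℚ) = 2 * m := by linarith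
      norm_cast at this
      omega
    · obtain rfl : n = m := by
        have : (n : ℚ) = m := by linarith
        exact_mod_cast this
      exact ht
  · exact fun h => Or.inr ⟨n, rfl, h⟩

theorem HasNUTerm.add_half {N : ℕ} (hV : V.HasNUTerm ((N : ℚ) / 2)) :
    V.HasNUTerm (((N + 1 : ℕ) : ℚ) / 2) := by
  rcases Nat.even_or_odd' N with ⟨n, rfl | rfl⟩
  · rw [show (((2 * n : ℕ) : ℚ) / 2) = n by push_cast; ring, hasNUTerm_natCast] at hV
    rw [show (((2 * n + 1 : ℕ) : ℚ) / 2) = n + 1 / 2 by push_cast; ring,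
      hasNUTerm_natCast_add_half]
    exact hV.elim fun _ => IsNUTerm.exists_isHalfNUTerm
  · rw [show (((2 * n + 1 : ℕ) : ℚ) / 2) = n + 1 / 2 by push_cast; ring,
      hasNUTerm_natCast_add_half] at hV
    rw [show (((2 * n + 1 + 1 : ℕ) : ℚ) / 2) = (n + 1 : ℕ) by push_cast; ring, hasNUTerm_natCast]
    exact hV.elim fun _ => IsHalfNUTerm.exists_isNUTerm

theorem HasNUTerm.mono_div_two {M N : ℕ} (hMN : M ≤ N) (hV : V.HasNUTerm ((M : ℚ) / 2)) :
    V.HasNUTerm ((N : ℚ) / 2) := by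
  induction N, hMN using Nat.le_induction with
  | base => exact hV
  | succ N _ ih => exact ih.add_half

end Positive

end Variety

theorem IsIntegerOrHalfInteger.exists_eq_div_two {h : ℚ} (hh : IsIntegerOrHalfInteger h) :
    ∃ N : ℕ, h = (N : ℚ) / 2 := by
  obtain ⟨n, rfl | rfl⟩ := hh
  · exact ⟨2 * n, by push_cast; ring⟩
  · exact ⟨2 * n + 1, by push_cast; ring⟩

namespace Variety

/-! ### Varieties generated by two-element algebras with one operation. -/

section OneOperation

/-- The symbols of a language with a single operation, of arity `r`. -/
inductive OpSymbol (r : ℕ) : ℕ → Type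
  | op : OpSymbol r r

/-- The language with a single operation symbol, of arity `r`. -/
def opLanguage (r : ℕ) : FirstOrder.Language.{0, 0} := ⟨OpSymbol r, fun _ => Empty⟩

instance (r : ℕ) : (opLanguage r).IsAlgebraic := fun _ => inferInstanceAs (IsEmpty Empty)

variable {r : ℕ}

/-- The two-element algebra with basic operation `f`. -/
def OpAlg (_f : (Fin r → Bool) → Bool) : Type := Bool

instance (f : (Fin r → Bool) → Bool) : (opLanguage r).Structure (OpAlg f) where
  funMap := fun {k} s x => match k, s, x with
    | _, .op, x => f x
  RelMap := fun e => Empty.elim e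

/-- The variety generated by the two-element algebras with basic operations `F i`. -/
abbrev opVariety {ι : Type} (F : ι → (Fin r → Bool) → Bool) : Variety.{0} where
  lang := opLanguage r
  isAlgebraic := inferInstance
  identities := {e | ∀ i (v : ℕ → OpAlg (F i)), e.1.realize v = e.2.realize v}

variable {ι : Type} {F : ι → (Fin r → Bool) → Bool}

theorem opVariety_mem (i : ι) : (opVariety F).Mem (OpAlg (F i)) := fun _ he => he i

/-- The value of a term in a two-element algebra. -/
def boolEval {α : Type} (f : (Fin r → Bool) → Bool) (t : (opLanguage r).Term α) (v : α → Bool) :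
    Bool :=
  Term.realize (M := OpAlg f) v t

/-- Identities of the generators are transferred to every member by renaming the variables to
natural numbers; nonemptiness supplies values for the unused ones. -/
theorem realize_eq_of_boolEval_eq {α : Type} [Countable α] {s t : (opVariety F).lang.Term α}
    (hst : ∀ i v, boolEval (F i) s v = boolEval (F i) t v)
    {A : Type} [Nonempty A] [(opVariety F).lang.Structure A] (hA : (opVariety F).Mem A)
    (v : α → A) : s.realize v = t.realize v := by
  obtain ⟨e, he⟩ := exists_injective_nat α
  have := hA (s.relabel e, t.relabel e)
    (fun i w => (Term.realize_relabel (M := OpAlg (F i))).trans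
      (Eq.trans (hst i (w ∘ e)) (Term.realize_relabel (M := OpAlg (F i))).symm)) (Function.extend e v fun _ => Classical.arbitrary A)
  rw [Term.realize_relabel, Term.realize_relabel] at this
  rwa [show Function.extend e v _ ∘ e = v from funext fun x => he.extend_apply _ _ x] at this

/-- An element of a finitely generated subalgebra is the value of a term in the generators,
determined by the finitely many Boolean functions that the term induces. -/
theorem opVariety_locallyFinite [Finite ι] : (opVariety F).LocallyFinite := by
  rintro A _ hA S ⟨s, rfl⟩
  have hmem := fun x : Substructure.closure (opVariety F).lang (s : Set A) =>
    Substructure.mem_closure_iff_exists_term.1 x.2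
  choose T hT using hmem
  refine Finite.of_injective
    (fun x (i : ι) (v : ↥(s : Set A) → Bool) => boolEval (F i) (T x) v) fun x y hxy => ?_
  have : Nonempty A := ⟨x⟩
  have : Countable (s : Set A) := s.finite_toSet.countable
  refine Subtype.ext ?_
  rw [← hT x, ← hT y]
  exact realize_eq_of_boolEval_eq (fun i v => congrFun (congrFun hxy i) v) hA _

/-- The basic operation applied to variables. -/
def opTerm (F : ι → (Fin r → Bool) → Bool) : (opVariety F).lang.Term (Fin r) :=
  Term.func (L := opLanguage r) OpSymbol.op Term.var

theorem boolEval_opTerm_relabel {α : Type} (f : (Fin r → Bool) → Bool) (g : Fin r → α)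
    (v : α → Bool) : boolEval f ((opTerm F).relabel g) v = f (v ∘ g) := rfl

theorem opVariety_hasNUTerm (hr : 3 ≤ r)
    (hF : ∀ i j x y, F i (Function.update (fun _ => x) j y) = x) : (opVariety F).HasNUTerm r := by
  refine hasNUTerm_natCast.2 ⟨opTerm F, hr, fun A _ hA j x y => ?_⟩
  have : Nonempty A := ⟨x⟩
  have := realize_eq_of_boolEval_eq (F := F) (s := (opTerm F).relabel fun p => if p = j then 1 else 0)
    (t := Term.var (0 : Fin 2)) (fun i v => by
      rw [boolEval_opTerm_relabel]
      refine Eq.trans (congrArg (F i) (funext fun p => ?_)) (hF i j (v 0) (v 1))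
      simp only [Function.comp, Function.update_apply]
      split_ifs <;> rfl) hA ![x, y]
  rw [Term.realize_relabel] at this
  refine Eq.trans (congrArg (opTerm F).realize (funext fun p => ?_)) this
  simp only [Function.comp, Function.update_apply]
  split_ifs <;> rfl

theorem opVariety_hasNUTerm_half {n : ℕ} (hn : 2 ≤ n) {F : ι → (Fin (n + 2) → Bool) → Bool}
    (h₁ : ∀ i x z, F i (fun j => if j.val < 2 then z else x) = x)
    (h₂ : ∀ i j x z, j ≠ 0 → F i (Function.update (fun _ => x) j z) = x)
    (h₃ : ∀ i x z, F i (fun j => if j.val < 3 then x else z) =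
      F i (fun j => if j.val < 1 then x else z)) : (opVariety F).HasNUTerm (n + 1 / 2) := by
  refine hasNUTerm_natCast_add_half.2 ⟨opTerm F, hn, fun A _ hA x z => ?_⟩
  have : Nonempty A := ⟨x⟩
  have comp : ∀ {B : Type} (v : Fin 2 → B) (P : Fin (n + 2) → Prop) [DecidablePred P],
      (v ∘ fun p => if P p then 0 else 1) = fun p => if P p then v 0 else v 1 := by
    intro B v P _
    funext p
    simp only [Function.comp]
    split_ifs <;> rfl
  refine ⟨?_, fun j hj => ?_, ?_⟩
  · have := realize_eq_of_boolEval_eq (F := F)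
      (s := (opTerm F).relabel fun p => if p.val < 2 then 0 else 1)
      (t := Term.var (1 : Fin 2)) (fun i v => by
        rw [boolEval_opTerm_relabel, comp]
        exact h₁ i (v 1) (v 0)) hA ![z, x]
    rwa [Term.realize_relabel, comp] at this
  · have := realize_eq_of_boolEval_eq (F := F)
      (s := (opTerm F).relabel fun p => if p = j then 0 else 1)
      (t := Term.var (1 : Fin 2)) (fun i v => by
        rw [boolEval_opTerm_relabel, comp]
        refine Eq.trans (congrArg (F i) (funext fun p => ?_)) (h₂ i j (v 1) (v 0) hj)
        simp only [Function.update_apply]) hA ![z, x]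
    rw [Term.realize_relabel, comp] at this
    refine Eq.trans (congrArg (opTerm F).realize (funext fun p => ?_)) this
    simp only [Function.update_apply]
    rfl
  · have := realize_eq_of_boolEval_eq (F := F)
      (s := (opTerm F).relabel fun p => if p.val < 3 then (0 : Fin 2) else 1)
      (t := (opTerm F).relabel fun p => if p.val < 1 then (0 : Fin 2) else 1) (fun i v => by
        rw [boolEval_opTerm_relabel, boolEval_opTerm_relabel, comp, comp]
        exact h₃ i (v 0) (v 1)) hA ![x, z]
    rwa [Term.realize_relabel, Term.realize_relabel, comp, comp] at this

/-- Compatible ternary relations between two-element algebras are preserved by terms. -/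
theorem boolEval_rel {α : Type} {f₁ f₂ f₃ : (Fin r → Bool) → Bool} (R : Bool → Bool → Bool → Prop)
    (hR : ∀ a b c : Fin r → Bool, (∀ j, R (a j) (b j) (c j)) → R (f₁ a) (f₂ b) (f₃ c))
    (t : (opLanguage r).Term α) (v₁ v₂ v₃ : α → Bool) (hv : ∀ x, R (v₁ x) (v₂ x) (v₃ x)) :
    R (boolEval f₁ t v₁) (boolEval f₂ t v₂) (boolEval f₃ t v₃) := by
  induction t with
  | var x => exact hv x
  | func s ts ih =>
    cases s
    exact hR _ _ _ ih

/-- The total weight of the places where `a` is true. -/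
def weight (w : Fin r → ℕ) (a : Fin r → Bool) : ℕ := ∑ j, if a j then w j else 0

theorem weight_le_add {w : Fin r → ℕ} {a b c : Fin r → Bool}
    (h : ∀ j, c j = true → a j = true ∨ b j = true) : weight w c ≤ weight w a + weight w b := by
  rw [weight, weight, weight, ← Finset.sum_add_distrib]
  refine Finset.sum_le_sum fun j _ => ?_
  have := h j
  revert this
  cases a j <;> cases b j <;> cases c j <;> simp

theorem weight_mono {w : Fin r → ℕ} {a c : Fin r → Bool}
    (h : ∀ j, c j = true → a j = true) : weight w c ≤ weight w a := by
  have := weight_le_add (w := w) (a := a) (b := fun _ => false) (c := c) fun j hj => Or.inl (h j hj)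
  simpa [weight] using this

/-- If `v₃` lies below the join of `v₁` and `v₂` and the weights are incompatible with this, then
no term takes the values `false`, `false`, `true` at `v₁`, `v₂`, `v₃`. -/
theorem boolEval_not_false_false_true {α : Type} {f₁ f₂ f₃ : (Fin r → Bool) → Bool} (w : Fin r → ℕ)
    {n₁ n₂ n₃ : ℕ} (h₁ : ∀ a, f₁ a = false → weight w a ≤ n₁)
    (h₂ : ∀ a, f₂ a = false → weight w a ≤ n₂) (h₃ : ∀ a, f₃ a = true → n₃ ≤ weight w a)
    (hn : n₁ + n₂ < n₃) {t : (opLanguage r).Term α} {v₁ v₂ v₃ : α → Bool}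
    (hv : ∀ x, v₃ x = true → v₁ x = true ∨ v₂ x = true)
    (e₁ : boolEval f₁ t v₁ = false) (e₂ : boolEval f₂ t v₂ = false) :
    boolEval f₃ t v₃ = false := by
  -- The relation `z ≤ x ∨ y` is compatible: a violation would give `n₃ ≤ n₁ + n₂` by subadditivity
  -- of weight.
  have := boolEval_rel (f₁ := f₁) (f₂ := f₂) (f₃ := f₃)
    (fun x y z => z = true → x = true ∨ y = true) (fun a b c habc hc => by
      by_contra! h
      have ha := h₁ a (by simpa using h.1)
      have hb := h₂ b (by simpa using h.2)
      have := weight_le_add (w := w) habc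
      have := h₃ c hc
      omega) t v₁ v₂ v₃ hv
  rw [e₁, e₂] at this
  simpa using this

/-- If the join of `v₁`, `v₂`, `v₃` is `true` and the weights are incompatible with this, then
no term is `false` at each of `v₁`, `v₂`, `v₃`. -/
theorem boolEval_not_false_false_false {α : Type} {f₁ f₂ f₃ : (Fin r → Bool) → Bool}
    (w : Fin r → ℕ) {n₁ n₂ n₃ : ℕ} (h₁ : ∀ a, f₁ a = false → weight w a ≤ n₁)
    (h₂ : ∀ a, f₂ a = false → weight w a ≤ n₂) (h₃ : ∀ a, f₃ a = false → weight w a ≤ n₃)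
    (hn : n₁ + n₂ + n₃ < ∑ j, w j) {t : (opLanguage r).Term α} {v₁ v₂ v₃ : α → Bool}
    (hv : ∀ x, v₁ x = true ∨ v₂ x = true ∨ v₃ x = true)
    (e₁ : boolEval f₁ t v₁ = false) (e₂ : boolEval f₂ t v₂ = false) :
    boolEval f₃ t v₃ = true := by
  have := boolEval_rel (f₁ := f₁) (f₂ := f₂) (f₃ := f₃)
    (fun x y z => x = true ∨ y = true ∨ z = true) (fun a b c habc => by
      by_contra! h
      have ha := h₁ a (by simpa using h.1)
      have hb := h₂ b (by simpa using h.2.1)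
      have hc := h₃ c (by simpa using h.2.2)
      have h₄ : weight w (fun j => a j || b j) ≤ _ := weight_le_add (w := w) (a := a) (b := b)
        (by simp)
      have h₅ : weight w (fun _ => true) ≤ _ := weight_le_add (w := w)
        (a := fun j => a j || b j) (b := c) (by simpa [or_assoc] using habc)
      simp [weight] at h₅
      simp [weight] at *
      omega) t v₁ v₂ v₃ hv
  rw [e₁, e₂] at this
  simpa using this

/-- The threshold operation: true if the weight is at least `θ`. -/
def threshold (w : Fin r → ℕ) (θ : ℕ) (a : Fin r → Bool) : Bool := decide (θ ≤ weight w a)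

theorem boolEval_threshold_mono {α : Type} {w : Fin r → ℕ} {θ : ℕ} (t : (opLanguage r).Term α)
    {v v' : α → Bool} (hv : ∀ x, v x = true → v' x = true)
    (h : boolEval (threshold w θ) t v = true) : boolEval (threshold w θ) t v' = true := by
  refine boolEval_rel (f₁ := threshold w θ) (f₂ := threshold w θ) (f₃ := threshold w θ)
    (fun x y _ => x = true → y = true) (fun a b _ hab ha => ?_) t v v' v hv h
  have := weight_mono (w := w) hab
  simp only [threshold, decide_eq_true_eq] at ha ⊢
  omega

end OneOperation

/-! ### Where chains of linked truth values must change. -/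

section Sequences

/-- If `p` forced `q` at every odd index below `m`, truth of both would propagate along the links up
to `m`. -/
theorem exists_odd_of_links {p q : ℕ → Bool} {m : ℕ} (hp0 : p 0 = true) (hpm : p m = false)
    (hqp : ∀ i, q i = true → p i = true) (hq0 : q 0 = true)
    (he : ∀ i < m, Even i → p i = p (i + 1)) (ho : ∀ i < m, Odd i → q i = q (i + 1)) :
    ∃ b, 2 * b + 1 < m ∧ p (2 * b + 1) = true ∧ q (2 * b + 1) = false := by
  by_contra! h
  have key : ∀ i ≤ m, p i = true ∧ q i = true := by
    intro i
    induction i with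
    | zero => exact fun _ => ⟨hp0, hq0⟩
    | succ i ih =>
      intro hi
      obtain ⟨h₁, h₂⟩ := ih (by omega)
      rcases Nat.even_or_odd' i with ⟨b, rfl | rfl⟩
      · have hp : p (2 * b + 1) = true := by rw [← he _ hi (even_two_mul b)]; exact h₁
        have : 2 * b + 1 ≠ m := by rintro rfl; simp_all
        exact ⟨hp, by simpa using h b (by omega) hp⟩
      · have hq : q (2 * b + 1 + 1) = true := by
          rw [← ho _ hi (odd_two_mul_add_one b)]; exact h₂
        exact ⟨hqp _ hq, hq⟩
  have := (key m le_rfl).1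
  simp_all

/-- The same propagation, started at `2 * a + 1` and with even and odd exchanged. Falsity of `q m`
makes the index found strictly smaller than `m`. -/
theorem exists_even_of_links {p q : ℕ → Bool} {m a : ℕ} (ham : 2 * a + 1 < m)
    (hpa : p (2 * a + 1) = true) (hpm : p m = false) (hqm : q m = false)
    (hpq : ∀ i, p i = true → q i = true)
    (he : ∀ i < m, Even i → p i = p (i + 1)) (ho : ∀ i < m, Odd i → q i = q (i + 1)) :
    ∃ b, a < b ∧ 2 * b < m ∧ p (2 * b) = false ∧ q (2 * b) = true := by
  by_contra! h
  have key : ∀ i, 2 * a + 1 ≤ i → i ≤ m → p i = true ∧ q i = true := by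
    intro i hai
    induction i, hai using Nat.le_induction with
    | base => exact fun _ => ⟨hpa, hpq _ hpa⟩
    | succ i hai ih =>
      intro hi
      obtain ⟨h₁, h₂⟩ := ih (by omega)
      rcases Nat.even_or_odd' i with ⟨b, rfl | rfl⟩
      · have hp : p (2 * b + 1) = true := by rw [← he _ hi (even_two_mul b)]; exact h₁
        exact ⟨hp, hpq _ hp⟩
      · have hq : q (2 * (b + 1)) = true := by
          rw [show 2 * (b + 1) = 2 * b + 1 + 1 by ring, ← ho _ hi (odd_two_mul_add_one b)]
          exact h₂
        have hbm : 2 * (b + 1) ≠ m := by rintro rfl; simp_all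
        refine ⟨?_, hq⟩
        by_contra hp
        exact h (b + 1) (by omega) (by omega) (Bool.eq_false_of_not_eq_true hp) hq
  have := (key m (by omega) le_rfl).1
  simp_all

theorem le_sub_of_injective {s c d : ℕ} (b : Fin s → ℕ) (hb : Function.Injective b)
    (hc : ∀ j, c ≤ b j) (hd : ∀ j, b j < d) : s ≤ d - c := by
  have := Finset.card_le_card_of_injOn (s := Finset.univ) (t := Finset.Ico c d) b
    (fun j _ => by simp [hc, hd]) hb.injOn
  simpa using this

end Sequences

/-! ### Different thresholds need different terms. -/

section Thresholds

variable {r : ℕ}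

/-- An operation together with the threshold operations for `2 * c`, `2 * (c + 1)`, …,
`2 * (c + s - 1)`. -/
def thresholdFamily (f : (Fin r → Bool) → Bool) (w : Fin r → ℕ) (c s : ℕ) :
    Option (Fin s) → (Fin r → Bool) → Bool
  | none => f
  | some j => threshold w (2 * (c + j))

variable {f : (Fin r → Bool) → Bool} {w : Fin r → ℕ} {c s m : ℕ}

theorem le_weight_of_threshold {θ : ℕ} (a : Fin r → Bool) (h : threshold w θ a = true) :
    θ ≤ weight w a := by
  simpa [threshold] using h

theorem weight_lt_of_threshold {θ : ℕ} (a : Fin r → Bool) (h : threshold w θ a = false) :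
    weight w a ≤ θ - 1 := by
  have : weight w a < θ := by simpa [threshold] using h
  omega

/-- Terms that are absorbing for the operation `f` do not jump over two thresholds. -/
theorem boolEval_threshold_eq_false_of_lt {α : Type} (hf : ∀ a, f a = false → weight w a ≤ 2)
    {j k : ℕ} (hj : 0 < j) (hjk : j < k) {t : (opLanguage r).Term α} {v₁ v₂ v₃ : α → Bool}
    (hv : ∀ x, v₃ x = true → v₁ x = true ∨ v₂ x = true)
    (e₁ : boolEval (threshold w (2 * j)) t v₁ = false) (e₂ : boolEval f t v₂ = false) :
    boolEval (threshold w (2 * k)) t v₃ = false :=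
  boolEval_not_false_false_true w weight_lt_of_threshold hf le_weight_of_threshold (by omega)
    hv e₁ e₂

/-- The Jónsson identities, evaluated in a two-element algebra. -/
def JonssonIn (f : (Fin r → Bool) → Bool) (t : ℕ → (opLanguage r).Term (Fin 3)) (m : ℕ) : Prop :=
  (∀ x y z, boolEval f (t 0) ![x, y, z] = x) ∧
  (∀ i ≤ m, ∀ x y, boolEval f (t i) ![x, y, x] = x) ∧
  (∀ i < m, Even i → ∀ x z, boolEval f (t i) ![x, x, z] = boolEval f (t (i + 1)) ![x, x, z]) ∧
  (∀ i < m, Odd i → ∀ x z, boolEval f (t i) ![x, z, z] = boolEval f (t (i + 1)) ![x, z, z]) ∧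
  (∀ x y z, boolEval f (t m) ![x, y, z] = z)

/-- The Day identities, evaluated in a two-element algebra. -/
def DayIn (f : (Fin r → Bool) → Bool) (t : ℕ → (opLanguage r).Term (Fin 4)) (m : ℕ) : Prop :=
  (∀ i ≤ m, ∀ x y, boolEval f (t i) ![x, y, y, x] = x) ∧
  (∀ x y z u, boolEval f (t 0) ![x, y, z, u] = x) ∧
  (∀ i < m, Even i → ∀ x u,
    boolEval f (t i) ![x, x, u, u] = boolEval f (t (i + 1)) ![x, x, u, u]) ∧
  (∀ i < m, Odd i → ∀ x y u,
    boolEval f (t i) ![x, y, y, u] = boolEval f (t (i + 1)) ![x, y, y, u]) ∧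
  (∀ x y z u, boolEval f (t m) ![x, y, z, u] = u)

theorem IsDistributive.exists_jonssonIn {ι : Type} {F : ι → (Fin r → Bool) → Bool}
    (h : (opVariety F).IsDistributive m) : ∃ t, ∀ i, JonssonIn (F i) t m := by
  obtain ⟨t, ht⟩ := h
  exact ⟨t, fun i => ht (OpAlg (F i)) (opVariety_mem i)⟩

theorem IsModular.exists_dayIn {ι : Type} {F : ι → (Fin r → Bool) → Bool}
    (h : (opVariety F).IsModular m) : ∃ t, ∀ i, DayIn (F i) t m := by
  obtain ⟨t, ht⟩ := h
  exact ⟨t, fun i => ht (OpAlg (F i)) (opVariety_mem i)⟩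

theorem exists_injective_of_jonssonIn (hf : ∀ a, f a = false → weight w a ≤ 2) (hc : 0 < c)
    {t : ℕ → (opLanguage r).Term (Fin 3)} (ht : ∀ i, JonssonIn (thresholdFamily f w c s i) t m) :
    ∃ b : Fin s → ℕ, Function.Injective b ∧ ∀ j : Fin s, 2 * b j + 1 < m ∧
      boolEval (threshold w (2 * (c + j))) (t (2 * b j + 1)) ![true, true, false] = true ∧
      boolEval (threshold w (2 * (c + j))) (t (2 * b j + 1)) ![true, false, false] = false := by
  have h₁ : ∀ j : Fin s, ∃ b, 2 * b + 1 < m ∧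
      boolEval (threshold w (2 * (c + j))) (t (2 * b + 1)) ![true, true, false] = true ∧
      boolEval (threshold w (2 * (c + j))) (t (2 * b + 1)) ![true, false, false] = false := by
    intro j
    obtain ⟨h0, h1, h2, h3, h4⟩ := ht (some j)
    exact exists_odd_of_links (h0 _ _ _) (h4 _ _ _)
      (fun i => boolEval_threshold_mono (t i) (by decide)) (h0 _ _ _) (fun i hi he => h2 i hi he _ _)
      (fun i hi he => h3 i hi he _ _)
  choose b hb using h₁
  refine ⟨b, fun j k hjk => ?_, hb⟩
  have hlt : ∀ j k : Fin s, b j = b k → ¬ j < k := fun j k hjk h => by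
    -- `(1,1,0)` is the join of `(1,0,0)`, false for the lower threshold, and `(0,1,0)`, false for
    -- the extra operation by absorption.
    have e := boolEval_threshold_eq_false_of_lt (j := c + j) (k := c + k)
      (v₃ := ![true, true, false]) hf (by omega) (by omega) (by decide) (hb j).2.2
      ((ht none).2.1 _ (hb j).1.le false true)
    rw [hjk, (hb k).2.1] at e
    cases e
  exact le_antisymm (not_lt.1 (hlt k j hjk.symm)) (not_lt.1 (hlt j k hjk))

/-- The odd index compares `(1,1,0,0)` with `(1,0,0,0)`, the later even one `(1,1,0,0)` with
`(1,1,1,0)`; inputs with equal middle entries are those preserved by odd links. The inequality `2 *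
d < m` sharpens the bound on `b j`. -/
theorem exists_injective_of_dayIn (hf : ∀ a, f a = false → weight w a ≤ 2) (hc : 0 < c)
    {t : ℕ → (opLanguage r).Term (Fin 4)} (ht : ∀ i, DayIn (thresholdFamily f w c s i) t m) :
    ∃ b : Fin s → ℕ, Function.Injective b ∧ ∀ j : Fin s,
      boolEval (threshold w (2 * (c + j))) (t (2 * b j + 1)) ![true, false, false, false] = false ∧
      ∃ d, b j < d ∧ 2 * d < m ∧
        boolEval (threshold w (2 * (c + j))) (t (2 * d)) ![true, true, true, false] = true := by
  have h₁ : ∀ j : Fin s, ∃ b, 2 * b + 1 < m ∧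
      boolEval (threshold w (2 * (c + j))) (t (2 * b + 1)) ![true, true, false, false] = true ∧
      boolEval (threshold w (2 * (c + j))) (t (2 * b + 1)) ![true, false, false, false] =
        false := by
    intro j
    obtain ⟨h0, h1, h2, h3, h4⟩ := ht (some j)
    exact exists_odd_of_links (h1 _ _ _ _) (h4 _ _ _ _)
      (fun i => boolEval_threshold_mono (t i) (by decide)) (h1 _ _ _ _)
      (fun i hi he => h2 i hi he _ _) (fun i hi he => h3 i hi he _ _ _)
  choose b hb using h₁
  refine ⟨b, fun j k hjk => ?_, fun j => ⟨(hb j).2.2, ?_⟩⟩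
  · have hlt : ∀ j k : Fin s, b j = b k → ¬ j < k := fun j k hjk h => by
      have e := boolEval_threshold_eq_false_of_lt (j := c + j) (k := c + k)
        (v₃ := ![true, true, false, false]) hf (by omega) (by omega) (by decide) (hb j).2.2
        ((ht none).1 _ (hb j).1.le false true)
      rw [hjk, (hb k).2.1] at e
      cases e
    exact le_antisymm (not_lt.1 (hlt k j hjk.symm)) (not_lt.1 (hlt j k hjk))
  · obtain ⟨h0, h1, h2, h3, h4⟩ := ht (some j)
    obtain ⟨d, hd₁, hd₂, -, hd₃⟩ := exists_even_of_links (hb j).1 (hb j).2.1 (h4 _ _ _ _)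
      (h4 _ _ _ _) (fun i => boolEval_threshold_mono (v' := ![true, true, true, false]) (t i)
        (by decide)) (fun i hi he => h2 i hi he _ _) (fun i hi he => h3 i hi he _ _ _)
    exact ⟨d, hd₁, hd₂, hd₃⟩

end Thresholds

/-! ### Counterexamples for integer parameters. -/

section Integer

theorem weight_two_const {n : ℕ} (x : Bool) :
    weight (fun _ : Fin n => 2) (fun _ => x) = if x then 2 * n else 0 := by
  cases x <;> simp [weight, mul_comm]

theorem weight_le_update {r : ℕ} {w : Fin r → ℕ} (j : Fin r) (x y : Bool) :
    weight w (Function.update (fun _ => x) j y) ≤ weight w (fun _ => x) + w j ∧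
      weight w (fun _ => x) ≤ weight w (Function.update (fun _ => x) j y) + w j := by
  have h : weight w (fun p => decide (p = j)) = w j := by simp [weight]
  constructor <;> rw [← h] <;> refine weight_le_add fun p hp => ?_ <;>
    by_cases hpj : p = j <;> simp_all [Function.update_of_ne]

theorem threshold_update {n θ : ℕ} (hθ : 2 ≤ θ) (hθn : θ + 1 ≤ n) (j : Fin n) (x y : Bool) :
    threshold (fun _ : Fin n => 2) (2 * θ) (Function.update (fun _ => x) j y) = x := by
  have := weight_le_update (w := fun _ : Fin n => 2) j x y
  rw [weight_two_const] at this
  cases x <;> simp [threshold] at this ⊢ <;> omega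

/-- The variety generated by the two-element algebras with the operations
"at least `θ` of the `n` arguments are true", `2 ≤ θ < n`. -/
abbrev integerVariety (n : ℕ) : Variety.{0} :=
  opVariety (thresholdFamily (threshold (fun _ : Fin n => 2) (2 * 2)) (fun _ => 2) 2 (n - 2))

theorem integerVariety_hasNUTerm {n : ℕ} (hn : 3 ≤ n) : (integerVariety n).HasNUTerm n := by
  refine opVariety_hasNUTerm hn fun i j x y => ?_
  cases i with
  | none => exact threshold_update le_rfl hn j x y
  | some i => exact threshold_update (by omega) (by omega) j x y

theorem weight_le_two_of_threshold {n : ℕ} (a : Fin n → Bool)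
    (h : threshold (fun _ : Fin n => 2) (2 * 2) a = false) : weight (fun _ => 2) a ≤ 2 := by
  have h₁ := weight_lt_of_threshold a h
  -- Parity improves the bound from 3 to 2.
  have h₂ : weight (fun _ => 2) a = 2 * ∑ j, if a j then 1 else 0 := by
    rw [weight, Finset.mul_sum]
    exact Finset.sum_congr rfl fun j _ => by split_ifs <;> rfl
  omega

theorem not_integerVariety_isDistributive {n : ℕ} (hn : 3 ≤ n) :
    ¬ (integerVariety n).IsDistributive (2 * n - 5) := fun h => by
  obtain ⟨t, ht⟩ := h.exists_jonssonIn
  obtain ⟨b, hb, hb'⟩ := exists_injective_of_jonssonIn weight_le_two_of_threshold two_pos ht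
  -- There are `n - 2` thresholds but only `n - 3` odd indices below `2 * n - 5`.
  have := le_sub_of_injective (c := 0) (d := n - 3) b hb (fun j => Nat.zero_le _) fun j => by
    have := (hb' j).1
    omega
  omega

theorem not_integerVariety_isModular {n : ℕ} (hn : 3 ≤ n) :
    ¬ (integerVariety n).IsModular (2 * n - 4) := fun h => by
  obtain ⟨t, ht⟩ := h.exists_dayIn
  obtain ⟨b, hb, hb'⟩ := exists_injective_of_dayIn weight_le_two_of_threshold two_pos ht
  -- Since `b j < d` and `2 * d < 2 * n - 4`, only `n - 3` values remain.
  have := le_sub_of_injective (c := 0) (d := n - 3) b hb (fun j => Nat.zero_le _) fun j => by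
    obtain ⟨-, d, h₁, h₂, -⟩ := hb' j
    omega
  omega

end Integer

/-! ### Counterexamples for half-integer parameters. -/

section HalfInteger

variable {n : ℕ}

/-- The weights `1, 1, 2, 2, …, 2`. -/
def halfWeight (n : ℕ) (j : Fin (n + 2)) : ℕ := if j.val < 2 then 1 else 2

/-- The operation that is true if the weight is at least `3` or if exactly the first argument is
true. -/
def halfOp (n : ℕ) (a : Fin (n + 2) → Bool) : Bool :=
  decide (3 ≤ weight (halfWeight n) a ∨ a 0 = true ∧ weight (halfWeight n) a = 1)

theorem weight_le_two_of_halfOp (a : Fin (n + 2) → Bool) (h : halfOp n a = false) :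
    weight (halfWeight n) a ≤ 2 := by
  simp only [halfOp, decide_eq_false_iff_not] at h
  omega

theorem sum_halfWeight : ∑ j, halfWeight n j = 2 * n + 2 := by
  simp [Fin.sum_univ_succ, halfWeight]
  omega

theorem weight_halfWeight_const (x : Bool) :
    weight (halfWeight n) (fun _ => x) = if x then 2 * n + 2 else 0 := by
  cases x <;> simp [weight, sum_halfWeight]

theorem weight_halfWeight_lt_one (x z : Bool) :
    weight (halfWeight n) (fun j => if j.val < 1 then x else z) =
      (if x then 1 else 0) + (if z then 2 * n + 1 else 0) := by
  cases x <;> cases z <;> simp [weight, Fin.sum_univ_succ, halfWeight] <;> omega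

theorem weight_halfWeight_lt_two (x z : Bool) :
    weight (halfWeight n) (fun j => if j.val < 2 then x else z) =
      (if x then 2 else 0) + (if z then 2 * n else 0) := by
  cases x <;> cases z <;> simp [weight, Fin.sum_univ_succ, halfWeight] <;> omega

theorem weight_halfWeight_lt_three (hn : 1 ≤ n) (x z : Bool) :
    weight (halfWeight n) (fun j => if j.val < 3 then x else z) =
      (if x then 4 else 0) + (if z then 2 * n - 2 else 0) := by
  obtain ⟨n, rfl⟩ := Nat.exists_eq_add_of_le' hn
  have h : ∀ i, ¬ i + 1 + 1 + 1 < 3 := by omega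
  cases x <;> cases z <;> simp [weight, Fin.sum_univ_succ, halfWeight, h] <;> omega

theorem halfWeight_le_two (j : Fin (n + 2)) : halfWeight n j ≤ 2 := by
  rw [halfWeight]
  split_ifs <;> omega

/-- The variety generated by the two-element algebras whose operations are `halfOp n` and the
thresholds `2 * θ`, `3 ≤ θ < n`, for the weights `1, 1, 2, …, 2`. -/
abbrev halfIntegerVariety (n : ℕ) : Variety.{0} :=
  opVariety (thresholdFamily (halfOp n) (halfWeight n) 3 (n - 3))

/-- The two sides of the jump identity have weights 4 and 1, or `2 * n - 2` and `2 * n + 1`.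
Thresholds from 6 to `2 * n - 2` separate neither pair. `halfOp` must be true at weight 4, so its
exceptional clause makes it true at the first argument alone. -/
theorem halfIntegerVariety_hasNUTerm (hn : 3 ≤ n) :
    (halfIntegerVariety n).HasNUTerm (n + 1 / 2) := by
  refine opVariety_hasNUTerm_half (by omega) (fun i x z => ?_) (fun i j x z hj => ?_)
    (fun i x z => ?_)
  · have h := weight_halfWeight_lt_two (n := n) z x
    rcases i with _ | i
    · simp only [thresholdFamily, halfOp, h]
      cases x <;> cases z <;> simp <;> omega
    · simp only [thresholdFamily, threshold, h]
      cases x <;> cases z <;> simp <;> omega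
  · have h := weight_le_update (w := halfWeight n) j x z
    have hw := halfWeight_le_two j
    rw [weight_halfWeight_const] at h
    rcases i with _ | i
    · simp only [thresholdFamily, halfOp, Function.update_of_ne hj.symm]
      cases x <;> simp at h ⊢ <;> omega
    · simp only [thresholdFamily, threshold]
      cases x <;> simp at h ⊢ <;> omega
  · have h₁ := weight_halfWeight_lt_one (n := n) x z
    have h₃ := weight_halfWeight_lt_three (n := n) (by omega) x z
    rcases i with _ | i
    · simp only [thresholdFamily, halfOp, h₁, h₃]
      cases x <;> cases z <;> simp <;>
        first | omega | (rw [Bool.eq_iff_iff]; simp; omega)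
    · simp only [thresholdFamily, threshold, h₁, h₃]
      cases x <;> cases z <;> simp <;> omega

/-- The `n - 3` thresholds meet `n - 2` odd indices, so plain counting fails; `halfOp` excludes the
first and the last of these indices. -/
theorem not_halfIntegerVariety_isDistributive (hn : 3 ≤ n) :
    ¬ (halfIntegerVariety n).IsDistributive (2 * n - 4) := fun h => by
  obtain ⟨t, ht⟩ := h.exists_jonssonIn
  obtain ⟨b, hb, hb'⟩ := exists_injective_of_jonssonIn weight_le_two_of_halfOp three_pos ht
  obtain ⟨h0, h1, h2, h3, h4⟩ := ht none
  have first : boolEval (halfOp n) (t 1) ![false, false, true] = false :=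
    (h2 0 (by omega) Even.zero _ _).symm.trans (h0 _ _ _)
  have last : boolEval (halfOp n) (t (2 * n - 5)) ![true, false, false] = false := by
    refine (h3 (2 * n - 5) (by omega) ⟨n - 3, by omega⟩ _ _).trans ?_
    rw [show 2 * n - 5 + 1 = 2 * n - 4 by omega]
    exact h4 _ _ _
  -- For `n = 3` there are no thresholds, and the first and last odd indices coincide: `t 1` is
  -- false for `halfOp` at all three unit vectors, although `2 + 2 + 2 < 8`.
  rcases hn.eq_or_lt with rfl | hn'
  · have := boolEval_not_false_false_false (halfWeight 3) weight_le_two_of_halfOp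
      weight_le_two_of_halfOp weight_le_two_of_halfOp (by rw [sum_halfWeight]; norm_num)
      (v₃ := ![true, false, false]) (by decide) first (h1 1 (by norm_num) false true)
    rw [show (1 : ℕ) = 2 * 3 - 5 from rfl, last] at this
    cases this
  have := le_sub_of_injective (c := 1) (d := n - 3) b hb (fun j => ?_) fun j => ?_
  · omega
  · by_contra hj
    obtain ⟨-, -, hj'⟩ := hb' j
    rw [show b j = 0 by omega] at hj'
    -- Falsity at the three unit vectors would bound the total weight `2 * n + 2` by `2 + 2 + (2 *
    -- (n - 1) - 1)`.
    have := boolEval_not_false_false_false (halfWeight n) weight_le_two_of_halfOp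
      weight_le_two_of_halfOp (weight_lt_of_threshold (θ := 2 * (3 + j)))
      (by rw [sum_halfWeight]; omega) (v₃ := ![true, false, false]) (by decide) first (h1 1 (by omega) false true)
    rw [this] at hj'
    cases hj'
  · by_contra hj
    obtain ⟨hjm, hj', -⟩ := hb' j
    rw [show 2 * b j + 1 = 2 * n - 5 by omega] at hj'
    -- Falsity at `(1,0,0)` and `(0,1,0)` bounds the weight by 4, below every threshold.
    have := boolEval_not_false_false_true (halfWeight n) weight_le_two_of_halfOp
      weight_le_two_of_halfOp (le_weight_of_threshold (θ := 2 * (3 + j))) (by omega)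
      (v₃ := ![true, true, false]) (by decide) last (h1 (2 * n - 5) (by omega) false true)
    rw [this] at hj'
    cases hj'

/-- `halfOp` excludes `b j = 0` as before, and the even index `2 * n - 4` as a value of `2 * d`;
this leaves `n - 4` values of `b` for `n - 3` thresholds. -/
theorem not_halfIntegerVariety_isModular (hn : 4 ≤ n) :
    ¬ (halfIntegerVariety n).IsModular (2 * n - 3) := fun h => by
  obtain ⟨t, ht⟩ := h.exists_dayIn
  obtain ⟨b, hb, hb'⟩ := exists_injective_of_dayIn weight_le_two_of_halfOp three_pos ht
  obtain ⟨h0, h1, h2, h3, h4⟩ := ht none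
  have first : boolEval (halfOp n) (t 1) ![false, false, true, true] = false :=
    (h2 0 (by omega) Even.zero _ _).symm.trans (h1 _ _ _ _)
  have last : boolEval (halfOp n) (t (2 * n - 4)) ![true, true, false, false] = false := by
    refine (h2 (2 * n - 4) (by omega) ⟨n - 2, by omega⟩ _ _).trans ?_
    rw [show 2 * n - 4 + 1 = 2 * n - 3 by omega]
    exact h4 _ _ _ _
  have := le_sub_of_injective (c := 1) (d := n - 3) b hb (fun j => ?_) fun j => ?_
  · omega
  · by_contra hj
    obtain ⟨hj', -⟩ := hb' j
    rw [show b j = 0 by omega] at hj'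
    have := boolEval_not_false_false_false (halfWeight n) weight_le_two_of_halfOp
      weight_le_two_of_halfOp (weight_lt_of_threshold (θ := 2 * (3 + j)))
      (by rw [sum_halfWeight]; omega) (v₃ := ![true, false, false, false]) (by decide) first (h0 1 (by omega) false true)
    rw [this] at hj'
    cases hj'
  · by_contra hj
    obtain ⟨-, d, hd₁, hd₂, hd₃⟩ := hb' j
    rw [show 2 * d = 2 * n - 4 by omega] at hd₃
    have := boolEval_not_false_false_true (halfWeight n) weight_le_two_of_halfOp
      weight_le_two_of_halfOp (le_weight_of_threshold (θ := 2 * (3 + j))) (by omega)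
      (v₃ := ![true, true, true, false]) (by decide) last (h0 (2 * n - 4) (by omega) false true)
    rw [this] at hd₃
    cases hd₃

end HalfInteger

/-! ### Uniform statements for `h = N / 2`, and the theorem. -/

theorem HasNUTerm.isDistributive {V : Variety.{u}} {N : ℕ} (hN : 6 ≤ N)
    (hV : V.HasNUTerm ((N : ℚ) / 2)) : V.IsDistributive (N - 4) := by
  rcases Nat.even_or_odd' N with ⟨n, rfl | rfl⟩
  · rw [show (((2 * n : ℕ) : ℚ) / 2) = n by push_cast; ring, hasNUTerm_natCast] at hV
    exact hV.elim fun _ => IsNUTerm.isDistributive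
  · rw [show (((2 * n + 1 : ℕ) : ℚ) / 2) = n + 1 / 2 by push_cast; ring,
      hasNUTerm_natCast_add_half] at hV
    rw [show 2 * n + 1 - 4 = 2 * n - 3 by omega]
    exact hV.elim fun _ ht => ht.isDistributive (by omega)

theorem HasNUTerm.isModular {V : Variety.{u}} {N : ℕ} (hN : 6 ≤ N)
    (hV : V.HasNUTerm ((N : ℚ) / 2)) : V.IsModular (N - 3) := by
  rcases Nat.even_or_odd' N with ⟨n, rfl | rfl⟩
  · rw [show (((2 * n : ℕ) : ℚ) / 2) = n by push_cast; ring, hasNUTerm_natCast] at hV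
    exact hV.elim fun _ => IsNUTerm.isModular
  · rw [show (((2 * n + 1 : ℕ) : ℚ) / 2) = n + 1 / 2 by push_cast; ring,
      hasNUTerm_natCast_add_half] at hV
    rw [show 2 * n + 1 - 3 = 2 * n - 2 by omega]
    exact hV.elim fun _ ht => ht.isModular (by omega)

theorem exists_not_isDistributive {N : ℕ} (hN : 6 ≤ N) :
    ∃ V : Variety.{0}, V.LocallyFinite ∧ V.HasNUTerm ((N : ℚ) / 2) ∧
      ¬ V.IsDistributive (N - 5) := by
  rcases Nat.even_or_odd' N with ⟨n, rfl | rfl⟩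
  · rw [show (((2 * n : ℕ) : ℚ) / 2) = n by push_cast; ring]
    exact ⟨integerVariety n, opVariety_locallyFinite, integerVariety_hasNUTerm (by omega),
      not_integerVariety_isDistributive (by omega)⟩
  · rw [show (((2 * n + 1 : ℕ) : ℚ) / 2) = n + 1 / 2 by push_cast; ring,
      show 2 * n + 1 - 5 = 2 * n - 4 by omega]
    exact ⟨halfIntegerVariety n, opVariety_locallyFinite,
      halfIntegerVariety_hasNUTerm (by omega), not_halfIntegerVariety_isDistributive (by omega)⟩

theorem exists_not_isModular {N : ℕ} (hN : 8 ≤ N) :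
    ∃ V : Variety.{0}, V.LocallyFinite ∧ V.HasNUTerm ((N : ℚ) / 2) ∧ ¬ V.IsModular (N - 4) := by
  rcases Nat.even_or_odd' N with ⟨n, rfl | rfl⟩
  · rw [show (((2 * n : ℕ) : ℚ) / 2) = n by push_cast; ring]
    exact ⟨integerVariety n, opVariety_locallyFinite, integerVariety_hasNUTerm (by omega),
      not_integerVariety_isModular (by omega)⟩
  · rw [show (((2 * n + 1 : ℕ) : ℚ) / 2) = n + 1 / 2 by push_cast; ring,
      show 2 * n + 1 - 4 = 2 * n - 3 by omega]
    exact ⟨halfIntegerVariety n, opVariety_locallyFinite,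
      halfIntegerVariety_hasNUTerm (by omega), not_halfIntegerVariety_isModular (by omega)⟩

end Variety

theorem theorem1p1 (h : ℚ) (hh : IsIntegerOrHalfInteger h) (hh3 : 3 ≤ h) :
    -- comparison of the conditions for different parameters
    (∀ k : ℚ, IsIntegerOrHalfInteger k → 3 ≤ k → h < k →
      (∀ V : Variety.{u}, V.HasNUTerm h → V.HasNUTerm k) ∧
      ∃ V : Variety.{0}, V.LocallyFinite ∧ V.HasNUTerm k ∧ ¬ V.HasNUTerm h) ∧
    -- distributivity levels
    (∃ d : ℕ, (d : ℚ) = 2 * h - 4 ∧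
      ∀ V : Variety.{u}, V.HasNUTerm h → V.IsDistributive d) ∧
    (∃ d : ℕ, (d : ℚ) = 2 * h - 5 ∧
      ∃ V : Variety.{0}, V.LocallyFinite ∧ V.HasNUTerm h ∧ ¬ V.IsDistributive d) ∧
    -- modularity levels
    (∃ d : ℕ, (d : ℚ) = 2 * h - 3 ∧
      ∀ V : Variety.{u}, V.HasNUTerm h → V.IsModular d) ∧
    (4 ≤ h → ∃ d : ℕ, (d : ℚ) = 2 * h - 4 ∧
      ∃ V : Variety.{0}, V.LocallyFinite ∧ V.HasNUTerm h ∧ ¬ V.IsModular d) := by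
  obtain ⟨N, rfl⟩ := hh.exists_eq_div_two
  have hN : 6 ≤ N := by
    have : (6 : ℚ) ≤ N := by linarith
    exact_mod_cast this
  refine ⟨fun k hk hk3 hlt => ?_, ⟨N - 4, ?_, fun V => Variety.HasNUTerm.isDistributive hN⟩,
    ⟨N - 5, ?_, Variety.exists_not_isDistributive hN⟩,
    ⟨N - 3, ?_, fun V => Variety.HasNUTerm.isModular hN⟩, fun h4 => ?_⟩
  · obtain ⟨M, rfl⟩ := hk.exists_eq_div_two
    have hNM : N < M := by
      have : (N : ℚ) < M := by linarith
      exact_mod_cast this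
    refine ⟨fun V => Variety.HasNUTerm.mono_div_two hNM.le, ?_⟩
    -- An `N / 2`-near-unanimity term would give `(N - 4)`-distributivity, hence `(M -
    -- 5)`-distributivity because `N < M`.
    obtain ⟨V, hV₁, hV₂, hV₃⟩ := Variety.exists_not_isDistributive (hN.trans hNM.le)
    exact ⟨V, hV₁, hV₂, fun hV => hV₃ ((hV.isDistributive hN).mono (by omega))⟩
  · rw [Nat.cast_sub (by omega)]; push_cast; ring
  · rw [Nat.cast_sub (by omega)]; push_cast; ring
  · rw [Nat.cast_sub (by omega)]; push_cast; ring
  · have hN8 : 8 ≤ N := by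
      have : (8 : ℚ) ≤ N := by linarith
      exact_mod_cast this
    exact ⟨N - 4, by rw [Nat.cast_sub (by omega)]; push_cast; ring,
      Variety.exists_not_isModular hN8⟩
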